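/- Let $K$ be a field. For a homogeneous ideal $I$ in a standard graded polynomial ring $R=K[x_1,\dots,x_m]$ (with $m\ge 0$ arbitrary) such that $R/I$ has Krull dimension $0$, the $h$-vector of $R/I$ is the sequence $(h_0,h_1,h_2,\dots)$ with $h_t=\dim_K (R/I)_t$, which has only finitely many nonzero terms. For $n\ge 1$ let $L(n)$ be the set of all $h$-vectors $h$ with $\sum_i h_i=n$, and for $k\ge 0$ let $L_k(n)=\{h\in L(n) : h_1=k\}$; put $\ell(n)=|L(n)|$ and $\ell_k(n)=|L_k(n)|$ (these sets are finite). Let $$s(n)=\min\left\{k\ge 0 : n\le \binom{k+2}{2}\right\},\qquad \tau(n)=\sum_{k=s(n)}^{n-1}\ell_k(n).$$ Then $\tau(n)\le \ell(n)$ for all $n\ge 1$, and $\tau$ is determined by the following recurrence: $\tau(1)=1$, and for every $n\ge 2$ one has $s(n-1)\le s(n)$ and $$\tau(n)=\begin{cases}\tau(n-1)+\ell_{s(n)}(n) & \text{if } s(n)=s(n-1),\\ \tau(n-1) & \text{if } s(n)>s(n-1).\end{cases}$$ -/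

import Mathlib

namespace HVec

attribute [local instance] MvPolynomial.gradedAlgebra

/-- The degree `t` component `(R/I)_t` of `R/I`, where `R = K[x_1, …, x_m]` is standard graded:
the image in `R/I` of the space of homogeneous polynomials of degree `t`. -/
noncomputable def gradedPiece (K : Type*) [Field K] {m : ℕ} (I : Ideal (MvPolynomial (Fin m) K))
    (t : ℕ) : Submodule K (MvPolynomial (Fin m) K ⧸ I) :=
  (MvPolynomial.homogeneousSubmodule (Fin m) K t).map (Ideal.Quotient.mkₐ K I).toLinearMap

/-- The Hilbert function `t ↦ dim_K (R/I)_t`. -/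
noncomputable def hilbertFunction (K : Type*) [Field K] {m : ℕ}
    (I : Ideal (MvPolynomial (Fin m) K)) (t : ℕ) : ℕ :=
  Module.finrank K (gradedPiece K I t)

/-- `h` is an `h`-vector (over `K`): it is the Hilbert function of a quotient `R/I` of Krull
dimension zero of a polynomial ring `R` in finitely many variables by a graded ideal `I`. The finite
vector `(h_0, …, h_s)` with `h_s ≠ 0` is recorded as a sequence, extended by zeros. -/
def IsHVector (K : Type*) [Field K] (h : ℕ → ℕ) : Prop :=
  ∃ (m : ℕ) (I : Ideal (MvPolynomial (Fin m) K)),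
    I.IsHomogeneous (MvPolynomial.homogeneousSubmodule (Fin m) K) ∧
    ringKrullDim (MvPolynomial (Fin m) K ⧸ I) = 0 ∧
    ∀ t, h t = hilbertFunction K I t

/-- The set `L(n)` of `h`-vectors of length `n`. The sum has only finitely many nonzero terms,
because `R/I` is of finite dimension when it has Krull dimension zero. -/
def L (K : Type*) [Field K] (n : ℕ) : Set (ℕ → ℕ) :=
  {h | IsHVector K h ∧ ∑ᶠ i, h i = n}

/-- `ℓ(n) = |L(n)|`. -/
noncomputable def ell (K : Type*) [Field K] (n : ℕ) : ℕ := (L K n).ncard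

/-- The set `L_k(n)` of `h`-vectors of length `n` with `h_1 = k`. -/
def Lk (K : Type*) [Field K] (k n : ℕ) : Set (ℕ → ℕ) := {h ∈ L K n | h 1 = k}

/-- `ℓ_k(n) = |L_k(n)|`. -/
noncomputable def ellk (K : Type*) [Field K] (k n : ℕ) : ℕ := (Lk K k n).ncard

/-- `s(n) = min {k ≥ 0 : n ≤ C(k+2, 2)}`. -/
noncomputable def s (n : ℕ) : ℕ := sInf {k : ℕ | n ≤ (k + 2).choose 2}

/-- `τ(n)`, the sum of `ℓ_k(n)` over `s(n) ≤ k ≤ n - 1`. -/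
noncomputable def tau (K : Type*) [Field K] (n : ℕ) : ℕ := ∑ k ∈ Finset.Ico (s n) n, ellk K k n

end HVec

namespace HVec

/-! ### Upper shadows and lexicographic segments. -/

open Finset Finset.Nat

/-! Everything rests on the bijection behind `ellk_succ`: if `n ≤ C(k+2,2)`, raising `h_1` by one
carries `L_k(n)` onto `L_{k+1}(n+1)`. The bound says exactly `k ≥ s(n)`, so the sum defining `τ(n)`
reappears, shifted, inside that of `τ(n+1)`. As `s` grows by 0 or 1, at most the bottom term is left
over.

To raise `h_1`, adjoin a variable whose product with every variable is zero (`exists_cone`). To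
lower it, count: `h_1 = k+1` and total `n+1` force `h_2 ≤ C(k+1,2)`. In the lexicographic model of
`h`, the largest variable present then divides no quadric of the model and can be deleted
(`exists_erase`).

These moves are made on multicomplexes. Standard monomials turn a Hilbert function into the count of
a multicomplex, and monomial ideals give the converse. The lexicographic model (`exists_lex`) needs
Macaulay's theorem `segGrowth`, proved by compression and induction on the number of variables. -/

/-- All monomials obtained from those in `A` by multiplication with one variable. -/
def up {n : ℕ} (A : Finset (Fin n → ℕ)) : Finset (Fin n → ℕ) :=
  A.biUnion fun u => univ.image fun i => u + Pi.single i 1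

/-- `L` is an upper lexicographic segment among the monomials of degree `d`. -/
def IsSeg {n : ℕ} (d : ℕ) (L : Finset (Fin n → ℕ)) : Prop :=
  L ⊆ antidiagonalTuple n d ∧
    ∀ u ∈ L, ∀ v ∈ antidiagonalTuple n d, toLex u ≤ toLex v → v ∈ L

theorem mem_up {n : ℕ} {A : Finset (Fin n → ℕ)} {v : Fin n → ℕ} :
    v ∈ up A ↔ ∃ u ∈ A, ∃ i, u + Pi.single i 1 = v := by
  simp [up]

theorem sum_add_single {n : ℕ} (u : Fin n → ℕ) (i : Fin n) :
    ∑ j, (u + Pi.single i 1 : Fin n → ℕ) j = ∑ j, u j + 1 := by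
  simp [sum_add_distrib]

theorem up_subset {n d : ℕ} {A : Finset (Fin n → ℕ)} (h : A ⊆ antidiagonalTuple n d) :
    up A ⊆ antidiagonalTuple n (d + 1) := by
  intro v hv
  obtain ⟨u, hu, i, rfl⟩ := mem_up.1 hv
  rw [mem_antidiagonalTuple, sum_add_single, mem_antidiagonalTuple.1 (h hu)]

theorem toLex_lt_iff {n : ℕ} {u v : Fin n → ℕ} :
    toLex u < toLex v ↔ ∃ i, (∀ j < i, u j = v j) ∧ u i < v i := Iff.rfl

/-- Segments of one degree are upper sets of a linear order, hence nested. Inclusions thus reduce to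
cardinalities. -/
theorem IsSeg.subset_of_card_le {n d : ℕ} {L L' : Finset (Fin n → ℕ)} (hL : IsSeg d L)
    (hL' : IsSeg d L') (h : #L ≤ #L') : L ⊆ L' := by
  by_contra hn
  obtain ⟨u, hu, hu'⟩ := not_subset.1 hn
  have hsub : L' ⊆ L := by
    intro v hv
    refine hL.2 u hu v (hL'.1 hv) ?_
    by_contra hlt
    exact hu' (hL'.2 v hv u (hL.1 hu) (not_le.1 hlt).le)
  exact hu' (eq_of_subset_of_card_le hsub h ▸ hu)

theorem exists_isSeg (n d k : ℕ) (hk : k ≤ #(antidiagonalTuple n d)) :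
    ∃ L : Finset (Fin n → ℕ), IsSeg d L ∧ #L = k := by
  induction k with
  | zero => exact ⟨∅, ⟨by simp, by simp⟩, rfl⟩
  | succ k ih =>
    obtain ⟨L, hL, hc⟩ := ih (by omega)
    have hne : (antidiagonalTuple n d \ L).Nonempty := by
      rw [← card_pos, card_sdiff_of_subset hL.1]; omega
    obtain ⟨m, hm, hmax⟩ := exists_max_image _ (fun u => toLex u) hne
    rw [mem_sdiff] at hm
    refine ⟨insert m L, ⟨insert_subset hm.1 hL.1, ?_⟩, by rw [card_insert_of_notMem hm.2, hc]⟩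
    intro u hu v hv huv
    by_cases hvL : v ∈ L
    · exact mem_insert_of_mem hvL
    have hvm := hmax v (mem_sdiff.2 ⟨hv, hvL⟩)
    rcases mem_insert.1 hu with rfl | hu
    · rw [mem_insert]
      left
      exact toLex.injective (le_antisymm hvm huv)
    · exact absurd (hL.2 u hu v hv huv) hvL

/-- The upper lexicographic segment of size `k` in degree `d`, or everything if `k` is too big. -/
noncomputable def lexSeg (n d k : ℕ) : Finset (Fin n → ℕ) :=
  (exists_isSeg n d (min k #(antidiagonalTuple n d)) (min_le_right _ _)).choose

theorem isSeg_lexSeg (n d k : ℕ) : IsSeg d (lexSeg n d k) :=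
  (exists_isSeg n d (min k #(antidiagonalTuple n d)) (min_le_right _ _)).choose_spec.1

theorem card_lexSeg (n d k : ℕ) : #(lexSeg n d k) = min k #(antidiagonalTuple n d) :=
  (exists_isSeg n d (min k #(antidiagonalTuple n d)) (min_le_right _ _)).choose_spec.2

theorem lexSeg_mono {n d k l : ℕ} (h : k ≤ l) : lexSeg n d k ⊆ lexSeg n d l :=
  (isSeg_lexSeg n d k).subset_of_card_le (isSeg_lexSeg n d l)
    (by rw [card_lexSeg, card_lexSeg]; exact min_le_min_right _ h)

theorem IsSeg.subset_lexSeg {n d k : ℕ} {L : Finset (Fin n → ℕ)} (hL : IsSeg d L) (h : #L ≤ k) :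
    L ⊆ lexSeg n d k :=
  hL.subset_of_card_le (isSeg_lexSeg n d k)
    (by rw [card_lexSeg]; exact le_min h (card_le_card hL.1))

theorem toLex_add_single_le {n : ℕ} (u : Fin n → ℕ) {i j : Fin n} (h : i ≤ j) :
    toLex (u + Pi.single j 1) ≤ toLex (u + Pi.single i 1) := by
  rcases h.eq_or_lt with rfl | h
  · exact le_rfl
  · refine le_of_lt (toLex_lt_iff.2 ⟨i, fun l hl => ?_, ?_⟩)
    · simp [hl.ne, (hl.trans h).ne]
    · simp [h.ne]

theorem exists_last_var {n d : ℕ} {v : Fin n → ℕ} (hv : ∑ i, v i = d + 1) :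
    ∃ (u : Fin n → ℕ) (i : Fin n), u + Pi.single i 1 = v ∧ ∀ j, i < j → v j = 0 := by
  have hne : (univ.filter fun i => v i ≠ 0).Nonempty := by
    by_contra h
    rw [not_nonempty_iff_eq_empty, filter_eq_empty_iff] at h
    have : ∑ i, v i = 0 := sum_eq_zero fun i hi => not_not.1 (h hi)
    omega
  obtain ⟨i, hi, hmax⟩ := exists_max_image _ id hne
  refine ⟨v - Pi.single i 1, i, ?_, fun j hj => ?_⟩
  · simp only [mem_filter, mem_univ, true_and] at hi
    ext l
    by_cases h : l = i
    · subst h; simp; omega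
    · simp [h]
  · by_contra h
    exact absurd (hmax j (by simpa using h)) (not_le.2 hj)

/-- Division of a monomial by its last variable leaves the largest possible quotient, and this
operation is weakly monotone on a fixed degree. So if `w` exceeds an element of the shadow, its
quotient `w'` already lies in `L`. -/
theorem IsSeg.up {n d : ℕ} {L : Finset (Fin n → ℕ)} (hL : IsSeg d L) : IsSeg (d + 1) (up L) := by
  refine ⟨up_subset hL.1, ?_⟩
  intro v hv w hw hvw
  rcases hvw.eq_or_lt with h | hlt
  · rwa [← toLex.injective h]
  have hvd := mem_antidiagonalTuple.1 (up_subset hL.1 hv)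
  have hwd := mem_antidiagonalTuple.1 hw
  obtain ⟨u, hu, i, rfl⟩ := mem_up.1 hv
  obtain ⟨u', i', hu', hlast'⟩ := exists_last_var hvd
  obtain ⟨w', k, rfl, hlastw⟩ := exists_last_var hwd
  have hud := mem_antidiagonalTuple.1 (hL.1 hu)
  have hwd' : ∑ j, w' j = d := by have := sum_add_single w' k; omega
  have hud' : ∑ j, u' j = d := by
    have := sum_add_single u' i'; rw [hu'] at this; omega
  refine mem_up.2 ⟨w', hL.2 u hu w' (mem_antidiagonalTuple.2 hwd') ?_, k, rfl⟩
  have huu' : toLex u ≤ toLex u' := by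
    have hii : i ≤ i' := by
      by_contra h
      have h1 := hlast' i (not_le.1 h)
      simp at h1
    rcases hii.eq_or_lt with rfl | hii
    · exact (congrArg toLex (add_right_cancel hu')).ge
    · refine le_of_lt (toLex_lt_iff.2 ⟨i, fun l hl => ?_, ?_⟩)
      · have := congrFun hu' l
        simp [hl.ne, (hl.trans hii).ne] at this
        exact this.symm
      · have := congrFun hu' i
        simp [hii.ne] at this
        omega
  refine huu'.trans ?_
  rw [← hu'] at hlt hlast'
  obtain ⟨p, hp, hpv⟩ := toLex_lt_iff.1 hlt
  -- If `p ≥ i'`, then `v` vanishes beyond `p`, so `v ≤ w` coordinatewise, strictly at `p`, against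
  -- equality of degrees.
  have hpi : p < i' := by
    by_contra h
    have hle : i' ≤ p := not_lt.1 h
    have h1 : ∑ j, (u' + Pi.single i' 1 : Fin n → ℕ) j <
        ∑ j, (w' + Pi.single k 1 : Fin n → ℕ) j := by
      refine sum_lt_sum (fun j _ => ?_) ⟨p, mem_univ _, hpv⟩
      rcases lt_trichotomy j p with hj | rfl | hj
      · exact (hp j hj).le
      · exact hpv.le
      · rw [hlast' j (hle.trans_lt hj)]; exact Nat.zero_le _
    rw [sum_add_single, sum_add_single] at h1
    omega
  have hpk : p ≤ k := by
    by_contra h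
    rw [hlastw p (not_le.1 h)] at hpv
    omega
  have hlow : ∀ j < p, u' j = w' j := by
    intro j hj
    have := hp j hj
    simpa [(hj.trans hpi).ne, (hj.trans_le hpk).ne] using this
  by_cases hup : u' p < w' p
  · exact le_of_lt (toLex_lt_iff.2 ⟨p, hlow, hup⟩)
  -- Here the difference at `p` came only from the factor removed from `w`. So `w'` vanishes beyond
  -- `p` and divides `u'`; having equal degrees, they coincide.
  · have hpk' : p = k := by
      by_contra h
      simp [hpi.ne, h] at hpv
      omega
    subst hpk'
    simp [hpi.ne] at hpv
    have hle : ∀ j, w' j ≤ u' j := by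
      intro j
      rcases lt_trichotomy j p with hj | rfl | hj
      · exact (hlow j hj).ge
      · omega
      · have := hlastw j hj
        simp at this
        omega
    have : w' = u' := by
      ext j
      by_contra hne
      have : ∑ j, w' j < ∑ j, u' j :=
        sum_lt_sum (fun j _ => hle j) ⟨j, mem_univ _, lt_of_le_of_ne (hle j) hne⟩
      omega
    rw [this]

/-! ### Compression along one variable. -/

section Fiber

variable {n : ℕ}

theorem sum_insertNth (i : Fin (n + 1)) (j : ℕ) (w : Fin n → ℕ) :
    ∑ l, (i.insertNth j w : Fin (n + 1) → ℕ) l = j + ∑ l, w l := by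
  simp [Fin.sum_univ_succAbove _ i]

theorem sum_removeNth (i : Fin (n + 1)) (v : Fin (n + 1) → ℕ) :
    v i + ∑ l, (i.removeNth v : Fin n → ℕ) l = ∑ l, v l := by
  simp [Fin.sum_univ_succAbove _ i, Fin.removeNth]

theorem insertNth_add_single (i : Fin (n + 1)) (j : ℕ) (w : Fin n → ℕ) (k : Fin n) :
    (i.insertNth j (w + Pi.single k 1 : Fin n → ℕ) : Fin (n + 1) → ℕ) =
      i.insertNth j w + Pi.single (i.succAbove k) 1 := by
  ext l
  rcases Fin.eq_self_or_eq_succAbove i l with rfl | ⟨l, rfl⟩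
  · simp [Fin.ne_succAbove]
  · simp [Pi.single_apply]

theorem insertNth_succ (i : Fin (n + 1)) (j : ℕ) (w : Fin n → ℕ) :
    (i.insertNth (j + 1) w : Fin (n + 1) → ℕ) = i.insertNth j w + Pi.single i 1 := by
  ext l
  rcases Fin.eq_self_or_eq_succAbove i l with rfl | ⟨l, rfl⟩
  · simp
  · simp [Fin.succAbove_ne]

theorem toLex_insertNth_lt {i : Fin (n + 1)} {j : ℕ} {w w' : Fin n → ℕ}
    (h : toLex w < toLex w') :
    toLex (i.insertNth j w : Fin (n + 1) → ℕ) < toLex (i.insertNth j w' : Fin (n + 1) → ℕ) := by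
  obtain ⟨p, hp, hlt⟩ := toLex_lt_iff.1 h
  refine toLex_lt_iff.2 ⟨i.succAbove p, fun l hl => ?_, by simpa using hlt⟩
  rcases Fin.eq_self_or_eq_succAbove i l with rfl | ⟨l, rfl⟩
  · simp
  · simpa using hp l (Fin.succAbove_lt_succAbove_iff.1 hl)

theorem toLex_insertNth_le_iff {i : Fin (n + 1)} {j : ℕ} {w w' : Fin n → ℕ} :
    toLex (i.insertNth j w : Fin (n + 1) → ℕ) ≤ toLex (i.insertNth j w' : Fin (n + 1) → ℕ) ↔
      toLex w ≤ toLex w' := by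
  constructor
  · intro h
    by_contra hn
    exact absurd h (not_le.2 (toLex_insertNth_lt (not_le.1 hn)))
  · intro h
    rcases h.eq_or_lt with h | h
    · rw [toLex.injective h]
    · exact (toLex_insertNth_lt h).le

/-- The fibre of `A` over the exponent `j` of the variable `i`. -/
def fiber (i : Fin (n + 1)) (j : ℕ) (A : Finset (Fin (n + 1) → ℕ)) : Finset (Fin n → ℕ) :=
  (A.filter fun v => v i = j).image i.removeNth

theorem mem_fiber {i : Fin (n + 1)} {j : ℕ} {A : Finset (Fin (n + 1) → ℕ)} {w : Fin n → ℕ} :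
    w ∈ fiber i j A ↔ (i.insertNth j w : Fin (n + 1) → ℕ) ∈ A := by
  simp only [fiber, mem_image, mem_filter]
  constructor
  · rintro ⟨v, ⟨hv, rfl⟩, rfl⟩
    rwa [Fin.insertNth_self_removeNth]
  · intro h
    exact ⟨_, ⟨h, by simp⟩, by simp⟩

theorem removeNth_mem_fiber {i : Fin (n + 1)} {A : Finset (Fin (n + 1) → ℕ)}
    {v : Fin (n + 1) → ℕ} : i.removeNth v ∈ fiber i (v i) A ↔ v ∈ A := by
  rw [mem_fiber, Fin.insertNth_self_removeNth]

theorem card_fiber (i : Fin (n + 1)) (j : ℕ) (A : Finset (Fin (n + 1) → ℕ)) :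
    #(fiber i j A) = #(A.filter fun v => v i = j) := by
  refine card_image_of_injOn fun u hu v hv h => ?_
  simp only [mem_coe, mem_filter] at hu hv
  rw [← Fin.insertNth_self_removeNth i u, ← Fin.insertNth_self_removeNth i v, hu.2, hv.2]
  exact congrArg _ h

theorem fiber_subset {i : Fin (n + 1)} {j e : ℕ} {A : Finset (Fin (n + 1) → ℕ)}
    (hA : A ⊆ antidiagonalTuple (n + 1) (j + e)) : fiber i j A ⊆ antidiagonalTuple n e := by
  intro w hw
  have := mem_antidiagonalTuple.1 (hA (mem_fiber.1 hw))
  rw [sum_insertNth] at this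
  rw [mem_antidiagonalTuple]
  omega

theorem card_eq_sum_fiber {d : ℕ} (i : Fin (n + 1)) {A : Finset (Fin (n + 1) → ℕ)}
    (hA : A ⊆ antidiagonalTuple (n + 1) d) : #A = ∑ j ∈ range (d + 1), #(fiber i j A) := by
  simp only [card_fiber]
  refine card_eq_sum_card_fiberwise fun v hv => ?_
  have := mem_antidiagonalTuple.1 (hA hv)
  have := single_le_sum (f := v) (fun _ _ => Nat.zero_le _) (mem_univ i)
  simp only [coe_range, Set.mem_Iio]
  omega

theorem up_fiber_subset (i : Fin (n + 1)) (j : ℕ) (A : Finset (Fin (n + 1) → ℕ)) :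
    up (fiber i j A) ⊆ fiber i j (up A) := by
  intro w hw
  obtain ⟨u, hu, k, rfl⟩ := mem_up.1 hw
  rw [mem_fiber, insertNth_add_single]
  exact mem_up.2 ⟨_, mem_fiber.1 hu, _, rfl⟩

theorem fiber_subset_fiber_up (i : Fin (n + 1)) (j : ℕ) (A : Finset (Fin (n + 1) → ℕ)) :
    fiber i j A ⊆ fiber i (j + 1) (up A) := by
  intro w hw
  rw [mem_fiber, insertNth_succ]
  exact mem_up.2 ⟨_, mem_fiber.1 hw, _, rfl⟩

theorem IsSeg.fiber {i : Fin (n + 1)} {j e : ℕ} {L : Finset (Fin (n + 1) → ℕ)}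
    (hL : IsSeg (j + e) L) : IsSeg e (fiber i j L) := by
  refine ⟨fiber_subset hL.1, fun u hu v hv huv => ?_⟩
  rw [mem_fiber] at hu ⊢
  refine hL.2 _ hu _ ?_ (toLex_insertNth_le_iff.2 huv)
  rw [mem_antidiagonalTuple, sum_insertNth, mem_antidiagonalTuple.1 hv]

/-- Replace every fibre of `A` with respect to the variable `i` by a lexicographic segment. -/
noncomputable def compress (i : Fin (n + 1)) (d : ℕ) (A : Finset (Fin (n + 1) → ℕ)) :
    Finset (Fin (n + 1) → ℕ) :=
  (antidiagonalTuple (n + 1) d).filter fun v =>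
    i.removeNth v ∈ lexSeg n (∑ l, (i.removeNth v : Fin n → ℕ) l) #(fiber i (v i) A)

theorem compress_subset (i : Fin (n + 1)) (d : ℕ) (A : Finset (Fin (n + 1) → ℕ)) :
    compress i d A ⊆ antidiagonalTuple (n + 1) d := filter_subset _ _

theorem fiber_compress (i : Fin (n + 1)) (j e : ℕ) (A : Finset (Fin (n + 1) → ℕ)) :
    fiber i j (compress i (j + e) A) = lexSeg n e #(fiber i j A) := by
  ext w
  simp only [mem_fiber, compress, mem_filter, mem_antidiagonalTuple, sum_insertNth,
    Fin.removeNth_insertNth, Fin.insertNth_apply_same, add_right_inj]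
  constructor
  · rintro ⟨rfl, h⟩
    exact h
  · intro h
    have := mem_antidiagonalTuple.1 ((isSeg_lexSeg _ _ _).1 h)
    exact ⟨this, by rwa [this]⟩

theorem card_fiber_compress (i : Fin (n + 1)) {j e : ℕ} {A : Finset (Fin (n + 1) → ℕ)}
    (hA : A ⊆ antidiagonalTuple (n + 1) (j + e)) :
    #(fiber i j (compress i (j + e) A)) = #(fiber i j A) := by
  rw [fiber_compress, card_lexSeg, min_eq_left (card_le_card (fiber_subset hA))]

theorem card_compress (i : Fin (n + 1)) {d : ℕ} {A : Finset (Fin (n + 1) → ℕ)}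
    (hA : A ⊆ antidiagonalTuple (n + 1) d) : #(compress i d A) = #A := by
  rw [card_eq_sum_fiber i hA, card_eq_sum_fiber i (compress_subset i d A)]
  refine sum_congr rfl fun j hj => ?_
  obtain ⟨e, rfl⟩ := Nat.exists_eq_add_of_le (Nat.lt_succ_iff.1 (mem_range.1 hj))
  exact card_fiber_compress i hA

/-- Lexicographic segments grow the least among all sets of monomials of degree `d`. -/
def SegGrowth (n : ℕ) : Prop :=
  ∀ (d : ℕ) (A L : Finset (Fin n → ℕ)), A ⊆ antidiagonalTuple n d → IsSeg d L → #L ≤ #A →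
    #(up L) ≤ #(up A)

/-- Multiplication by the variable `i` moves a fibre unchanged to the next exponent. Multiplication
by another variable stays in the fibre, where the shadow of a segment is a segment, no larger than
the original shadow by `hn`. Nestedness does the rest. -/
theorem up_compress_subset (hn : SegGrowth n) (i : Fin (n + 1)) {d : ℕ}
    {A : Finset (Fin (n + 1) → ℕ)} (hA : A ⊆ antidiagonalTuple (n + 1) d) :
    up (compress i d A) ⊆ compress i (d + 1) (up A) := by
  intro v hv
  obtain ⟨u, hu, k, rfl⟩ := mem_up.1 hv
  obtain ⟨j, w, rfl⟩ : ∃ j w, u = i.insertNth j w :=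
    ⟨u i, i.removeNth u, (Fin.insertNth_self_removeNth i u).symm⟩
  have hd := mem_antidiagonalTuple.1 (compress_subset i d A hu)
  rw [sum_insertNth] at hd
  obtain ⟨e, he⟩ : ∃ e, e = ∑ l, w l := ⟨_, rfl⟩
  rw [← he] at hd
  subst hd
  rw [← mem_fiber, fiber_compress] at hu
  rcases Fin.eq_self_or_eq_succAbove i k with rfl | ⟨k, rfl⟩
  · rw [← insertNth_succ, ← mem_fiber, show j + e + 1 = (j + 1) + e by ring, fiber_compress]
    exact lexSeg_mono (card_le_card (fiber_subset_fiber_up _ _ _)) hu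
  · rw [← insertNth_add_single, ← mem_fiber, add_assoc, fiber_compress]
    refine (isSeg_lexSeg n e _).up.subset_lexSeg (k := #(fiber i j (up A))) ?_
      (mem_up.2 ⟨w, hu, k, rfl⟩)
    refine (hn e (fiber i j A) _ (fiber_subset hA) (isSeg_lexSeg _ _ _) ?_).trans
      (card_le_card (up_fiber_subset i j A))
    rw [card_lexSeg]
    exact min_le_left _ _

theorem card_up_compress_le (hn : SegGrowth n) (i : Fin (n + 1)) {d : ℕ}
    {A : Finset (Fin (n + 1) → ℕ)} (hA : A ⊆ antidiagonalTuple (n + 1) d) :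
    #(up (compress i d A)) ≤ #(up A) :=
  (card_le_card (up_compress_subset hn i hA)).trans (card_compress i (up_subset hA)).le

/-- This is the potential function for compression: each fibre trades elements for lexicographically
larger ones, so the whole set rises in colex order. -/
theorem toColex_le_compress (i : Fin (n + 1)) {d : ℕ} {A : Finset (Fin (n + 1) → ℕ)}
    (hA : A ⊆ antidiagonalTuple (n + 1) d) :
    toColex (A.image toLex) ≤ toColex ((compress i d A).image toLex) := by
  rw [Finset.Colex.toColex_le_toColex]
  intro x hx hx'
  obtain ⟨u, hu, rfl⟩ := mem_image.1 hx
  have hu' : u ∉ compress i d A := fun h => hx' (mem_image_of_mem _ h)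
  obtain ⟨j, w, rfl⟩ : ∃ j w, u = i.insertNth j w :=
    ⟨u i, i.removeNth u, (Fin.insertNth_self_removeNth i u).symm⟩
  have hd := mem_antidiagonalTuple.1 (hA hu)
  rw [sum_insertNth] at hd
  obtain ⟨e, he⟩ : ∃ e, e = ∑ l, w l := ⟨_, rfl⟩
  rw [← he] at hd
  subst hd
  have hc := card_fiber_compress i hA
  rw [← mem_fiber] at hu hu'
  obtain ⟨w', hw', hwn⟩ : ∃ w' ∈ fiber i j (compress i (j + e) A), w' ∉ fiber i j A := by
    by_contra! h
    exact hu' ((eq_of_subset_of_card_le h hc.ge).symm ▸ hu)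
  refine ⟨_, mem_image_of_mem _ (mem_fiber.1 hw'), ?_, toLex_insertNth_le_iff.2 ?_⟩
  · rw [toLex.injective.mem_finset_image, ← mem_fiber]
    exact hwn
  · rw [fiber_compress] at hw' hu'
    by_contra hlt
    exact hu' ((isSeg_lexSeg _ _ _).2 w' hw' w (mem_antidiagonalTuple.2 he.symm)
      (not_le.1 hlt).le)

theorem mem_of_compress_eq {i : Fin (n + 1)} {d : ℕ} {A : Finset (Fin (n + 1) → ℕ)}
    (hA : compress i d A = A) {u v : Fin (n + 1) → ℕ} (hu : u ∈ A)
    (hv : v ∈ antidiagonalTuple (n + 1) d) (hi : u i = v i) (huv : toLex u ≤ toLex v) :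
    v ∈ A := by
  have hud := mem_antidiagonalTuple.1 (compress_subset i d A (hA.symm ▸ hu))
  have hvd := mem_antidiagonalTuple.1 hv
  have hu' := removeNth_mem_fiber (i := i).2 hu
  rw [← removeNth_mem_fiber (i := i)]
  have hru := sum_removeNth i u
  have hrv := sum_removeNth i v
  rw [hud] at hru
  rw [hvd] at hrv
  rw [← hA, ← hru, fiber_compress] at hu'
  rw [← hA, ← hrv, fiber_compress, ← hi]
  have he : ∑ l, (i.removeNth u : Fin n → ℕ) l = ∑ l, (i.removeNth v : Fin n → ℕ) l := by omega
  rw [he] at hu'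
  refine (isSeg_lexSeg _ _ _).2 _ hu' _ (mem_antidiagonalTuple.2 rfl) ?_
  rw [← toLex_insertNth_le_iff (i := i) (j := v i), Fin.insertNth_self_removeNth, ← hi,
    Fin.insertNth_self_removeNth]
  exact huv

/-- Among sets of the same size with no larger shadow, take a colex-maximal one. Compression stays
in this family and never lowers the set, so it fixes it. -/
theorem exists_compressed (hn : SegGrowth n) {d : ℕ} {A : Finset (Fin (n + 1) → ℕ)}
    (hA : A ⊆ antidiagonalTuple (n + 1) d) :
    ∃ B ⊆ antidiagonalTuple (n + 1) d, #B = #A ∧ #(up B) ≤ #(up A) ∧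
      ∀ i, compress i d B = B := by
  obtain ⟨B, hB, hmax⟩ := exists_max_image
    ((antidiagonalTuple (n + 1) d).powerset.filter fun B => #B = #A ∧ #(up B) ≤ #(up A))
    (fun B => toColex (B.image toLex)) ⟨A, by simpa using hA⟩
  simp only [mem_filter, mem_powerset] at hB hmax
  refine ⟨B, hB.1, hB.2.1, hB.2.2, fun i => ?_⟩
  have h := hmax (compress i d B) ⟨compress_subset i d B,
    (card_compress i hB.1).trans hB.2.1, (card_up_compress_le hn i hB.1).trans hB.2.2⟩
  exact image_injective toLex.injective
    (toColex.injective (le_antisymm h (toColex_le_compress i hB.1)))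

end Fiber

/-! ### Macaulay's growth theorem. -/

/-- If the last variable `x` divides `u`, then `u * y = (u * y / x) * x`, and `u * y / x` is at
least `u`, so it is in the segment. Beyond `L * x`, only monomials free of `x` contribute. With
`le_card_up`, comparing shadows reduces to comparing fibres over exponent 0. -/
theorem card_up_le_of_isSeg {n d : ℕ} {L : Finset (Fin (n + 1) → ℕ)} (hL : IsSeg d L) :
    #(up L) ≤ #(up (fiber (Fin.last n) 0 L)) + #L := by
  have hsub : up L ⊆ (up (fiber (Fin.last n) 0 L)).image ((Fin.last n).insertNth 0) ∪
      L.image (fun u => u + Pi.single (Fin.last n) 1) := by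
    intro v hv
    obtain ⟨u, hu, k, rfl⟩ := mem_up.1 hv
    rw [mem_union]
    rcases Fin.eq_self_or_eq_succAbove (Fin.last n) k with rfl | ⟨k, rfl⟩
    · exact Or.inr (mem_image_of_mem _ hu)
    obtain ⟨j, w, rfl⟩ : ∃ j w, u = (Fin.last n).insertNth j w :=
      ⟨u (Fin.last n), (Fin.last n).removeNth u, (Fin.insertNth_self_removeNth _ u).symm⟩
    rw [← insertNth_add_single]
    cases j with
    | zero => exact Or.inl (mem_image_of_mem _ (mem_up.2 ⟨w, mem_fiber.2 hu, k, rfl⟩))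
    | succ j =>
      right
      rw [insertNth_succ]
      refine mem_image_of_mem _ (hL.2 _ hu _ ?_ ?_)
      · have := mem_antidiagonalTuple.1 (hL.1 hu)
        rw [sum_insertNth] at this
        rw [mem_antidiagonalTuple, sum_insertNth, sum_add_single, ← this]
        ring
      · rw [insertNth_succ, insertNth_add_single]
        exact toLex_add_single_le _ (Fin.le_last _)
  exact (card_le_card hsub).trans ((card_union_le _ _).trans
    (add_le_add card_image_le card_image_le))

theorem le_card_up {n : ℕ} (A : Finset (Fin (n + 1) → ℕ)) :
    #(up (fiber (Fin.last n) 0 A)) + #A ≤ #(up A) := by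
  have hsub : (up (fiber (Fin.last n) 0 A)).image ((Fin.last n).insertNth 0) ∪
      A.image (fun u => u + Pi.single (Fin.last n) 1) ⊆ up A := by
    refine union_subset (fun v hv => ?_) (fun v hv => ?_)
    · obtain ⟨w, hw, rfl⟩ := mem_image.1 hv
      exact mem_fiber.1 (up_fiber_subset _ _ _ hw)
    · obtain ⟨u, hu, rfl⟩ := mem_image.1 hv
      exact mem_up.2 ⟨u, hu, _, rfl⟩
  refine le_trans (le_of_eq ?_) (card_le_card hsub)
  rw [card_union_of_disjoint, card_image_of_injective _ (Fin.insertNth_right_injective _),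
    card_image_of_injective _ (add_left_injective _)]
  rw [disjoint_left]
  intro v hv hv'
  obtain ⟨w, -, rfl⟩ := mem_image.1 hv
  obtain ⟨u, -, hu⟩ := mem_image.1 hv'
  have := congrFun hu (Fin.last n)
  simp at this

/-- If the claim fails, some `u` in `L` free of the last variable is missing from `A`.
Compressedness then puts all of `A` strictly above `u`, so `A` is a proper subset of `L`, against
`#L ≤ #A`. -/
theorem card_fiber_zero_le {m d : ℕ} {A L : Finset (Fin (m + 3) → ℕ)}
    (hA : A ⊆ antidiagonalTuple (m + 3) d) (hc : ∀ i, compress i d A = A)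
    (hL : IsSeg d L) (hcard : #L ≤ #A) :
    #(fiber (Fin.last (m + 2)) 0 L) ≤ #(fiber (Fin.last (m + 2)) 0 A) := by
  by_contra hlt
  obtain ⟨w, hwL, hwA⟩ : ∃ w ∈ fiber (Fin.last (m + 2)) 0 L, w ∉ fiber (Fin.last (m + 2)) 0 A := by
    by_contra! h
    exact hlt (card_le_card h)
  rw [mem_fiber] at hwL hwA
  set u : Fin (m + 3) → ℕ := (Fin.last (m + 2)).insertNth 0 w with hu
  have hul : u (Fin.last (m + 2)) = 0 := by simp [hu]
  have hud := mem_antidiagonalTuple.1 (hL.1 hwL)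
  set pen : Fin (m + 3) := (Fin.last (m + 1)).castSucc with hpen
  have hpl : pen ≠ Fin.last (m + 2) := (Fin.castSucc_lt_last _).ne
  have hgt : ∀ v ∈ A, toLex u < toLex v := by
    intro v hv
    have hvd := mem_antidiagonalTuple.1 (hA hv)
    -- `v'` transfers the last exponent of `v` to the penultimate variable. This raises `v` and
    -- keeps its exponent at 0, a variable distinct from these two because there are at least three.
    set v' : Fin (m + 3) → ℕ := fun i =>
      if i = Fin.last (m + 2) then 0 else if i = pen then v pen + v (Fin.last (m + 2)) else v i
      with hv'
    have hlow : ∀ j < pen, v' j = v j := fun j hj => by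
      simp [hv', hj.ne, (hj.trans (Fin.castSucc_lt_last _)).ne]
    have hv'p : v' pen = v pen + v (Fin.last (m + 2)) := by simp [hv', hpl]
    have hv'l : v' (Fin.last (m + 2)) = 0 := by simp [hv']
    have hsum : ∀ x : Fin (m + 3) → ℕ, ∑ i, x i =
        ∑ i : Fin (m + 1), x i.castSucc.castSucc + x pen + x (Fin.last (m + 2)) := fun x => by
      rw [Fin.sum_univ_castSucc, Fin.sum_univ_castSucc]
    have hcc : ∀ i : Fin (m + 1), i.castSucc.castSucc < pen := fun i =>
      Fin.castSucc_lt_castSucc_iff.2 (Fin.castSucc_lt_last i)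
    have hv'd : ∑ i, v' i = d := by
      rw [← hvd, hsum v', hsum v, hv'p, hv'l, sum_congr rfl fun i _ => hlow _ (hcc i)]
      ring
    have hge : toLex v ≤ toLex v' := by
      by_cases h0 : v (Fin.last (m + 2)) = 0
      · refine (congrArg toLex (funext fun i => ?_)).le
        by_cases h1 : i = Fin.last (m + 2)
        · rw [h1, hv'l, h0]
        · by_cases h2 : i = pen
          · rw [h2, hv'p, h0, add_zero]
          · simp [hv', h1, h2]
      · exact le_of_lt (toLex_lt_iff.2 ⟨pen, fun j hj => (hlow j hj).symm, by omega⟩)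
    have hv'A : v' ∈ A := by
      refine mem_of_compress_eq (hc 0) hv (mem_antidiagonalTuple.2 hv'd) ?_ hge
      refine (hlow 0 ?_).symm
      exact Fin.pos_iff_ne_zero.2 (by simp [hpen, Fin.ext_iff])
    have hlt' : toLex u < toLex v' := by
      by_contra hle
      exact hwA (mem_of_compress_eq (hc (Fin.last (m + 2))) hv'A (hL.1 hwL) (by rw [hv'l, hul])
        (not_lt.1 hle))
    obtain ⟨p, hp, hpv⟩ := toLex_lt_iff.1 hlt'
    rcases lt_trichotomy p pen with h | rfl | h
    · exact toLex_lt_iff.2 ⟨p, fun j hj => by rw [hp j hj, hlow j (hj.trans h)],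
        by rwa [← hlow p h]⟩
    -- Both monomials are free of the last variable and agree before `pen`, so equal degree makes
    -- them agree at `pen` too.
    · have h1 := hsum u
      have h2 := hsum v'
      rw [sum_congr rfl fun i _ => hp _ (hcc i)] at h1
      omega
    · have : p = Fin.last (m + 2) := by
        refine le_antisymm (Fin.le_last p) ?_
        simp only [hpen, Fin.lt_def, Fin.val_castSucc, Fin.val_last, Fin.le_def] at h ⊢
        omega
      rw [this, hv'l] at hpv
      omega
  have hss : A ⊂ L := (ssubset_iff_of_subset fun v hv =>
    hL.2 u hwL v (hA hv) (hgt v hv).le).2 ⟨u, hwL, hwA⟩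
  exact absurd (card_lt_card hss) (by omega)

theorem card_antidiagonalTuple_one (d : ℕ) : #(antidiagonalTuple 1 d) = 1 := by
  rw [antidiagonalTuple_one, card_singleton]

/-- **Macaulay's theorem** for sets of monomials. -/
theorem segGrowth : ∀ n, SegGrowth n
  | 0 => fun d A L _ _ _ => by
    rw [eq_empty_of_forall_notMem (s := up L) fun v hv => ?_]
    · simp
    · obtain ⟨_, _, i, _⟩ := mem_up.1 hv
      exact i.elim0
  | 1 => fun d A L hA hL hcard => by
    rcases L.eq_empty_or_nonempty with rfl | hne
    · simp [up]
    · have h1 := card_le_card (up_subset hL.1)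
      have h2 := le_card_up A
      have h3 := hne.card_pos
      rw [card_antidiagonalTuple_one] at h1
      omega
  -- With two variables the penultimate one is the variable 0, so the compression argument is
  -- unavailable. Instead, a nonempty segment has shadow at most `#L + 1`, while any nonempty `A`
  -- has shadow at least `#A + 1`.
  | 2 => fun d A L hA hL hcard => by
    rcases L.eq_empty_or_nonempty with rfl | hne
    · simp [up]
    have hL1 := card_up_le_of_isSeg hL
    have hL2 : #(up (fiber (Fin.last 1) 0 L)) ≤ 1 := by
      refine (card_le_card (up_subset (d := d) (fiber_subset ?_))).trans
        (card_antidiagonalTuple_one _).le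
      simpa using hL.1
    have hAne : A.Nonempty := by
      have := hne.card_pos
      exact card_pos.1 (by omega)
    obtain ⟨u, hu, hmax⟩ := exists_max_image A (fun u => u 0) hAne
    have hss : A.image (fun u => u + Pi.single 1 1) ⊂ up A := by
      refine (ssubset_iff_of_subset fun v hv => ?_).2
        ⟨u + Pi.single 0 1, mem_up.2 ⟨u, hu, 0, rfl⟩, fun h => ?_⟩
      · obtain ⟨w, hw, rfl⟩ := mem_image.1 hv
        exact mem_up.2 ⟨w, hw, 1, rfl⟩
      · obtain ⟨w, hw, h⟩ := mem_image.1 h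
        have h1 := congrFun h 0
        have h2 := hmax w hw
        simp at h1
        omega
    have := card_lt_card hss
    rw [card_image_of_injective _ (add_left_injective _)] at this
    omega
  | m + 3 => fun d A L hA hL hcard => by
    have ih := segGrowth (m + 2)
    obtain ⟨B, hB, hBc, hBup, hBcomp⟩ := exists_compressed ih hA
    have h1 := card_fiber_zero_le hB hBcomp hL (by omega)
    have h2 := ih d (fiber (Fin.last (m + 2)) 0 B) (fiber (Fin.last (m + 2)) 0 L)
      (fiber_subset (by simpa using hB)) (IsSeg.fiber (by simpa using hL)) h1
    have h3 := card_up_le_of_isSeg hL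
    have h4 := le_card_up B
    omega

/-! ### Multicomplexes: lexicographic models, deletion and addition of a variable. -/

/-- A finite nonempty set of monomials closed under taking divisors. -/
def IsMulticomplex {m : ℕ} (M : Finset (Fin m → ℕ)) : Prop :=
  0 ∈ M ∧ ∀ u i, u + Pi.single i 1 ∈ M → u ∈ M

/-- The number of elements of degree `t` of a set of monomials. -/
def count {m : ℕ} (M : Finset (Fin m → ℕ)) (t : ℕ) : ℕ := #(M.filter fun u => ∑ i, u i = t)

variable {m : ℕ}

theorem IsMulticomplex.mem_of_le {M : Finset (Fin m → ℕ)} (hM : IsMulticomplex M) :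
    ∀ {v u : Fin m → ℕ}, v ∈ M → u ≤ v → u ∈ M := by
  suffices h : ∀ (k : ℕ) (u w : Fin m → ℕ), ∑ i, w i = k → u + w ∈ M → u ∈ M by
    intro v u hv huv
    exact h _ u (v - u) rfl (by rwa [add_tsub_cancel_of_le huv])
  intro k
  induction k with
  | zero =>
    intro u w hw hm
    have : w = 0 := funext fun i => sum_eq_zero_iff.1 hw i (mem_univ i)
    rwa [this, add_zero] at hm
  | succ k ih =>
    intro u w hw hm
    obtain ⟨w', i, rfl, -⟩ := exists_last_var hw
    rw [← add_assoc] at hm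
    exact ih u w' (by rw [sum_add_single] at hw; omega) (hM.2 _ i hm)

theorem eq_zero_of_sum_eq_zero {u : Fin m → ℕ} (h : ∑ i, u i = 0) : u = 0 :=
  funext fun i => sum_eq_zero_iff.1 h i (mem_univ i)

theorem exists_eq_single_of_sum_eq_one {u : Fin m → ℕ} (h : ∑ i, u i = 1) :
    ∃ i, u = Pi.single i 1 := by
  obtain ⟨u', i, rfl, -⟩ := exists_last_var h
  rw [sum_add_single] at h
  exact ⟨i, by rw [eq_zero_of_sum_eq_zero (u := u') (by omega), zero_add]⟩

theorem filter_eq_antidiagonalTuple_inter (M : Finset (Fin m → ℕ)) (t : ℕ) :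
    M.filter (fun u => ∑ i, u i = t) = antidiagonalTuple m t ∩ M := by
  ext u
  simp [mem_antidiagonalTuple, and_comm]

/-- In each degree, replace the complement of `M` by the upper segment of the same size. By
Macaulay's theorem the shadow of each segment fits into the next, so what remains is closed under
divisors. -/
theorem IsMulticomplex.exists_lex {M : Finset (Fin m → ℕ)} (hM : IsMulticomplex M) :
    ∃ N : Finset (Fin m → ℕ), IsMulticomplex N ∧ (∀ t, count N t = count M t) ∧
      ∀ u ∈ N, ∀ v, ∑ i, v i = ∑ i, u i → toLex v ≤ toLex u → v ∈ N := by
  obtain ⟨A, hA⟩ : ∃ A : ℕ → Finset (Fin m → ℕ), ∀ t, A t = antidiagonalTuple m t \ M :=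
    ⟨_, fun _ => rfl⟩
  have hAT : ∀ t, A t ⊆ antidiagonalTuple m t := fun t => by rw [hA]; exact sdiff_subset
  obtain ⟨L, hL⟩ : ∃ L : ℕ → Finset (Fin m → ℕ), ∀ t, L t = lexSeg m t #(A t) :=
    ⟨_, fun _ => rfl⟩
  have hseg : ∀ t, IsSeg t (L t) := fun t => by rw [hL]; exact isSeg_lexSeg _ _ _
  have hcard : ∀ t, #(L t) = #(A t) := fun t => by
    rw [hL, card_lexSeg, min_eq_left (card_le_card (hAT t))]
  have hup : ∀ t, up (L t) ⊆ L (t + 1) := fun t => by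
    refine (hseg t).up.subset_of_card_le (hseg (t + 1)) ?_
    rw [hcard]
    refine (segGrowth m t (A t) (L t) (hAT t) (hseg t) (hcard t).le).trans (card_le_card ?_)
    intro v hv
    have hvd := up_subset (hAT t) hv
    obtain ⟨u, hu, i, rfl⟩ := mem_up.1 hv
    rw [hA, mem_sdiff] at hu ⊢
    exact ⟨hvd, fun h => hu.2 (hM.2 _ _ h)⟩
  obtain ⟨N, hN⟩ : ∃ N : Finset (Fin m → ℕ), ∀ u, u ∈ N ↔ u ∉ L (∑ i, u i) := by
    refine ⟨((M.image fun u => ∑ i, u i).biUnion fun t => antidiagonalTuple m t).filter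
      fun u => u ∉ L (∑ i, u i), fun u => ?_⟩
    rw [mem_filter, and_iff_right_iff_imp]
    intro hu
    simp only [mem_biUnion, mem_image, mem_antidiagonalTuple]
    by_contra! h
    refine hu ?_
    -- In a degree where `M` is empty the segment is everything. This confines `N` to finitely many
    -- degrees.
    have hAall : A (∑ i, u i) = antidiagonalTuple m (∑ i, u i) := by
      rw [hA, Finset.sdiff_eq_self_iff_disjoint, disjoint_left]
      exact fun v hv hv' => h _ ⟨v, hv', rfl⟩ (mem_antidiagonalTuple.1 hv).symm
    have := eq_of_subset_of_card_le (hseg (∑ i, u i)).1 (by rw [hcard, hAall])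
    rw [this, mem_antidiagonalTuple]
  have hcount : ∀ t, count N t = count M t := fun t => by
    have h1 : N.filter (fun u => ∑ i, u i = t) = antidiagonalTuple m t \ L t := by
      ext u
      simp only [mem_filter, mem_sdiff, mem_antidiagonalTuple, hN]
      constructor
      · rintro ⟨h, rfl⟩; exact ⟨rfl, h⟩
      · rintro ⟨rfl, h⟩; exact ⟨h, rfl⟩
    rw [count, count, h1, filter_eq_antidiagonalTuple_inter, card_sdiff_of_subset (hseg t).1,
      hcard, hA]
    have := card_sdiff_add_card_inter (antidiagonalTuple m t) M
    omega
  refine ⟨N, ⟨?_, fun u i hu => ?_⟩, hcount, fun u hu v hvd hvu => ?_⟩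
  · have h0 : 0 < count N 0 := by
      rw [hcount]
      exact card_pos.2 ⟨0, by simp [hM.1]⟩
    obtain ⟨u, hu⟩ := card_pos.1 h0
    rw [mem_filter] at hu
    rw [← eq_zero_of_sum_eq_zero hu.2]
    exact hu.1
  · rw [hN, sum_add_single] at hu
    rw [hN]
    exact fun h => hu (hup _ (mem_up.2 ⟨u, h, i, rfl⟩))
  · rw [hN] at hu ⊢
    rw [hvd]
    exact fun h => hu ((hseg _).2 v h u (mem_antidiagonalTuple.2 rfl) hvu)

theorem card_filter_single_mem (N : Finset (Fin m → ℕ)) :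
    #(univ.filter fun i => (Pi.single i 1 : Fin m → ℕ) ∈ N) = count N 1 := by
  refine card_bij (fun i _ => Pi.single i 1) (fun i hi => ?_) (fun i _ j _ h => ?_) fun u hu => ?_
  · simp only [mem_filter, mem_univ, true_and] at hi
    simp [hi]
  · by_contra hij
    have := congrFun h i
    simp [hij] at this
  · rw [mem_filter] at hu
    obtain ⟨i, rfl⟩ := exists_eq_single_of_sum_eq_one hu.2
    exact ⟨i, by simpa using hu.1, rfl⟩

theorem count_erase (N : Finset (Fin m → ℕ)) {u : Fin m → ℕ} (hu : u ∈ N) (t : ℕ) :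
    count (N.erase u) t = count N t - if ∑ i, u i = t then 1 else 0 := by
  rw [count, count, filter_erase]
  split_ifs with h
  · exact card_erase_of_mem (mem_filter.2 ⟨hu, h⟩)
  · rw [erase_eq_of_notMem (by simp [h]), Nat.sub_zero]

/-- In the lexicographic model the largest variable `p` present divides no quadric. Otherwise all
`C(k+1,2)` quadrics in the other `k` variables, being smaller, would be present as well, one too
many. Hence `p` can be erased. -/
theorem IsMulticomplex.exists_erase {M : Finset (Fin m → ℕ)} (hM : IsMulticomplex M) {k : ℕ}
    (h1 : count M 1 = k + 1) (h2 : count M 2 ≤ (k + 1).choose 2) :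
    ∃ N : Finset (Fin m → ℕ), IsMulticomplex N ∧
      ∀ t, count N t = count M t - if 1 = t then 1 else 0 := by
  obtain ⟨N, hN, hc, hlex⟩ := hM.exists_lex
  obtain ⟨S, hS⟩ : ∃ S, S = univ.filter fun i => (Pi.single i 1 : Fin m → ℕ) ∈ N := ⟨_, rfl⟩
  have hmem : ∀ i, i ∈ S ↔ (Pi.single i 1 : Fin m → ℕ) ∈ N := by simp [hS]
  have hScard : #S = k + 1 := by rw [hS, card_filter_single_mem, hc, h1]
  obtain ⟨p, hp, hmin⟩ := exists_min_image S id (card_pos.1 (by omega))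
  simp only [id] at hmin
  have key : ∀ i, (Pi.single p 1 + Pi.single i 1 : Fin m → ℕ) ∉ N := by
    intro i hi
    have hiS : i ∈ S := (hmem i).2 (hN.2 _ p (by rwa [add_comm]))
    -- Quadratic monomials are unordered pairs of variables, so `card_sym2` counts them.
    obtain ⟨f, hf⟩ : ∃ f : Sym2 (Fin m) → Fin m → ℕ,
        ∀ a b, f s(a, b) = Pi.single a 1 + Pi.single b 1 :=
      ⟨Sym2.lift ⟨fun a b => Pi.single a 1 + Pi.single b 1, fun a b => add_comm _ _⟩,
        fun a b => rfl⟩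
    have hinj : Function.Injective f := by
      intro x y
      induction x with | _ a b
      induction y with | _ c d
      rw [hf, hf, Pi.single_add_single_eq_single_add_single one_ne_zero one_ne_zero, Sym2.eq_iff]
      intro h
      rcases h with ⟨rfl, rfl⟩ | ⟨-, rfl, rfl⟩ | ⟨h, -⟩
      · exact Or.inl ⟨rfl, rfl⟩
      · exact Or.inr ⟨rfl, rfl⟩
      · simp at h
    have hmem2 : ∀ x ∈ (S.erase p).sym2, f x ∈ N ∧ f x p = 0 ∧ ∑ l, f x l = 2 := by
      intro x
      induction x with | _ a b
      rw [Finset.mk_mem_sym2_iff, mem_erase, mem_erase, hf]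
      rintro ⟨⟨hap, ha⟩, hbp, hb⟩
      have hpa : p < a := lt_of_le_of_ne (hmin a ha) (Ne.symm hap)
      have hpb : p < b := lt_of_le_of_ne (hmin b hb) (Ne.symm hbp)
      have hpi := hmin i hiS
      refine ⟨hlex _ hi _ (by simp [sum_add_distrib]) (le_of_lt (toLex_lt_iff.2
        ⟨p, fun j hj => ?_, ?_⟩)), ?_, ?_⟩
      · simp [hj.ne, (hj.trans hpa).ne, (hj.trans hpb).ne, (hj.trans_le hpi).ne]
      · simp [hpa.ne, hpb.ne]
      · simp [hpa.ne, hpb.ne]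
      · simp [sum_add_distrib]
    have hsub : insert (Pi.single p 1 + Pi.single i 1) ((S.erase p).sym2.image f) ⊆
        N.filter fun u => ∑ l, u l = 2 := by
      refine insert_subset (mem_filter.2 ⟨hi, by simp [sum_add_distrib]⟩) fun u hu => ?_
      obtain ⟨x, hx, rfl⟩ := mem_image.1 hu
      exact mem_filter.2 ⟨(hmem2 x hx).1, (hmem2 x hx).2.2⟩
    have hle := card_le_card hsub
    rw [card_insert_of_notMem, card_image_of_injective _ hinj, card_sym2, card_erase_of_mem hp,
      hScard] at hle
    · have := hc 2
      simp only [count] at this h2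
      simp only [Nat.add_sub_cancel] at hle
      omega
    · intro h
      obtain ⟨x, hx, h⟩ := mem_image.1 h
      have h3 := (hmem2 x hx).2.1
      rw [h] at h3
      simp at h3
  refine ⟨N.erase (Pi.single p 1), ⟨mem_erase.2 ⟨?_, hN.1⟩, fun u i hu => ?_⟩, fun t => ?_⟩
  · intro h
    have := congrFun h p
    simp at this
  · refine mem_erase.2 ⟨?_, hN.2 u i (mem_of_mem_erase hu)⟩
    rintro rfl
    exact key i (mem_of_mem_erase hu)
  · rw [count_erase N ((hmem p).1 hp), hc]
    simp

/-- The new variable is added alone: no multiple of it of higher degree enters, so only degree 1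
changes. -/
theorem IsMulticomplex.exists_cone {M : Finset (Fin m → ℕ)} (hM : IsMulticomplex M) :
    ∃ N : Finset (Fin (m + 1) → ℕ), IsMulticomplex N ∧
      ∀ t, count N t = count M t + if 1 = t then 1 else 0 := by
  have hnot : (Pi.single (Fin.last m) 1 : Fin (m + 1) → ℕ) ∉
      M.image ((Fin.last m).insertNth 0) := by
    intro h
    obtain ⟨w, -, h⟩ := mem_image.1 h
    have := congrFun h (Fin.last m)
    simp at this
  refine ⟨insert (Pi.single (Fin.last m) 1) (M.image ((Fin.last m).insertNth 0)),
    ⟨mem_insert_of_mem (mem_image.2 ⟨0, hM.1, ?_⟩), fun u i hu => ?_⟩, fun t => ?_⟩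
  · ext l
    rcases Fin.eq_self_or_eq_succAbove (Fin.last m) l with rfl | ⟨l, rfl⟩
    · rw [Fin.insertNth_apply_same]; rfl
    · rw [Fin.insertNth_apply_succAbove]; rfl
  · refine mem_insert_of_mem ?_
    obtain ⟨j, w, rfl⟩ : ∃ j w, u = (Fin.last m).insertNth j w :=
      ⟨u (Fin.last m), (Fin.last m).removeNth u, (Fin.insertNth_self_removeNth _ u).symm⟩
    rcases mem_insert.1 hu with h | h
    · have h3 : ∑ l, ((Fin.last m).insertNth j w + Pi.single i 1 : Fin (m + 1) → ℕ) l = 1 := by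
        rw [h]; simp
      rw [sum_add_single, sum_insertNth] at h3
      have hw : w = 0 := eq_zero_of_sum_eq_zero (by omega)
      have hj : j = 0 := by omega
      rw [hw, hj]
      exact mem_image_of_mem _ hM.1
    · obtain ⟨w', hw', h⟩ := mem_image.1 h
      rcases Fin.eq_self_or_eq_succAbove (Fin.last m) i with rfl | ⟨i, rfl⟩
      · have := congrFun h (Fin.last m)
        simp at this
      · rw [← insertNth_add_single] at h
        obtain ⟨h3, rfl⟩ := Fin.insertNth_inj.1 h
        rw [← h3]
        exact mem_image_of_mem _ (hM.2 _ _ hw')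
  · rw [count, count, filter_insert, filter_image]
    simp only [sum_insertNth, zero_add]
    split_ifs with h h' h'
    · rw [card_insert_of_notMem, card_image_of_injective _ (Fin.insertNth_right_injective _)]
      exact fun h => hnot (image_subset_image (filter_subset _ _) h)
    · simp at h; omega
    · simp at h; omega
    · rw [card_image_of_injective _ (Fin.insertNth_right_injective _), add_zero]

/-! ### Hilbert functions and multicomplexes. -/

open Classical in
/-- The dimension of the span of a finite ordered family is the number of members which are not
in the span of the preceding ones. -/
theorem finrank_span_image_eq_card {K V ι κ : Type*} [Field K] [AddCommGroup V] [Module K V]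
    [LinearOrder κ] (f : ι → V) (r : ι → κ) (hr : Function.Injective r) (T : Finset ι) :
    Module.finrank K (Submodule.span K (f '' T)) =
      #(T.filter fun u => f u ∉ Submodule.span K (f '' {v | v ∈ T ∧ r v < r u})) := by
  induction T using Finset.induction_on_max_value r with
  | empty =>
    rw [coe_empty, Set.image_empty, Submodule.span_empty, finrank_bot, filter_empty, card_empty]
  | insert a S ha hle ih =>
    have hmax : ∀ x ∈ S, r x < r a := fun x hx =>
      lt_of_le_of_ne (hle x hx) fun h => ha (hr h ▸ hx)
    have hset : {v | v ∈ insert a S ∧ r v < r a} = (S : Set ι) := by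
      ext v
      simp only [mem_insert, Set.mem_ofPred_eq, mem_coe]
      constructor
      · rintro ⟨rfl | h, hlt⟩
        · exact absurd hlt (lt_irrefl _)
        · exact h
      · exact fun h => ⟨Or.inr h, hmax v h⟩
    have hset' : ∀ u ∈ S, {v | v ∈ insert a S ∧ r v < r u} = {v | v ∈ S ∧ r v < r u} := by
      intro u hu
      ext v
      simp only [mem_insert, Set.mem_ofPred_eq]
      constructor
      · rintro ⟨rfl | h, hlt⟩
        · exact absurd hlt (hmax u hu).not_gt
        · exact ⟨h, hlt⟩
      · exact fun h => ⟨Or.inr h.1, h.2⟩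
    have hfil : (S.filter fun u =>
          f u ∉ Submodule.span K (f '' {v | v ∈ insert a S ∧ r v < r u})) =
        S.filter fun u => f u ∉ Submodule.span K (f '' {v | v ∈ S ∧ r v < r u}) :=
      filter_congr fun u hu => by rw [hset' u hu]
    rw [filter_insert, hset, hfil, coe_insert, Set.image_insert_eq]
    split_ifs with h
    · rw [Submodule.span_insert_eq_span h, ih]
    · rw [card_insert_of_notMem fun h' => ha (mem_filter.1 h').1, ← ih, Submodule.span_insert]
      have hfin : FiniteDimensional K (Submodule.span K (f '' (S : Set ι))) :=
        FiniteDimensional.span_of_finite K (S.finite_toSet.image f)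
      have h0 : f a ≠ 0 := fun h0 => h (h0 ▸ Submodule.zero_mem _)
      have hdis := ((Submodule.disjoint_span_singleton' h0).2 h).symm
      have := Submodule.finrank_sup_add_finrank_inf_eq (Submodule.span K {f a})
        (Submodule.span K (f '' (S : Set ι)))
      rw [hdis.eq_bot, finrank_bot, finrank_span_singleton h0] at this
      omega

section Algebra

open MvPolynomial

attribute [local instance] MvPolynomial.gradedAlgebra

variable {K : Type*} [Field K] {m : ℕ}

/-- The class of the monomial with exponent vector `u` in `R/I`. -/
noncomputable def monomialClass (I : Ideal (MvPolynomial (Fin m) K)) (u : Fin m → ℕ) :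
    MvPolynomial (Fin m) K ⧸ I :=
  Ideal.Quotient.mk I (monomial (Finsupp.equivFunOnFinite.symm u) 1)

theorem monomialClass_add_single (I : Ideal (MvPolynomial (Fin m) K)) (u : Fin m → ℕ)
    (i : Fin m) :
    monomialClass I (u + Pi.single i 1) = Ideal.Quotient.mk I (X i) * monomialClass I u := by
  have h : Finsupp.equivFunOnFinite.symm (u + Pi.single i 1) =
      Finsupp.single i 1 + Finsupp.equivFunOnFinite.symm u := by
    ext j
    simp [Finsupp.single_apply, Pi.single_apply, add_comm, eq_comm]
  rw [monomialClass, monomialClass, h, ← map_mul, X, monomial_mul, one_mul]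

theorem degree_equivFunOnFinite_symm (u : Fin m → ℕ) :
    (Finsupp.equivFunOnFinite.symm u).degree = ∑ i, u i := by
  simp [Finsupp.degree_eq_sum]

theorem gradedPiece_eq_span (I : Ideal (MvPolynomial (Fin m) K)) (t : ℕ) :
    gradedPiece K I t =
      Submodule.span K (monomialClass I '' (antidiagonalTuple m t : Finset (Fin m → ℕ))) := by
  apply le_antisymm
  · rintro _ ⟨p, hp, rfl⟩
    replace hp : p.IsHomogeneous t := hp
    rw [p.as_sum, map_sum]
    refine Submodule.sum_mem _ fun s hs => ?_
    have hd : ∑ i, s i = t := by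
      rw [← Finsupp.degree_eq_sum, Finsupp.degree_eq_weight_one]
      exact hp (mem_support_iff.1 hs)
    have h1 : (monomial s (coeff s p) : MvPolynomial (Fin m) K) =
        coeff s p • monomial s 1 := by
      rw [smul_monomial, smul_eq_mul, mul_one]
    rw [h1, map_smul]
    refine Submodule.smul_mem _ _ (Submodule.subset_span ⟨s, ?_, ?_⟩)
    · exact mem_coe.2 (mem_antidiagonalTuple.2 hd)
    · simp [monomialClass]
  · rw [Submodule.span_le]
    rintro _ ⟨u, hu, rfl⟩
    refine ⟨monomial (Finsupp.equivFunOnFinite.symm u) 1, ?_, rfl⟩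
    refine isHomogeneous_monomial _ ?_
    rw [degree_equivFunOnFinite_symm]
    exact mem_antidiagonalTuple.1 (mem_coe.1 hu)

/-- `u` is a standard monomial if it is not, modulo `I`, a linear combination of smaller monomials
of the same degree. -/
def IsStandard (I : Ideal (MvPolynomial (Fin m) K)) (u : Fin m → ℕ) : Prop :=
  monomialClass I u ∉ Submodule.span K
    (monomialClass I '' {v | v ∈ antidiagonalTuple m (∑ i, u i) ∧ toLex v < toLex u})

/-- Multiplying by a variable preserves the order, so a relation expressing `u` through smaller
monomials yields one for its multiple. -/
theorem IsStandard.of_add_single {I : Ideal (MvPolynomial (Fin m) K)} {u : Fin m → ℕ} {i : Fin m}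
    (h : IsStandard I (u + Pi.single i 1)) : IsStandard I u := by
  intro hu
  apply h
  rw [monomialClass_add_single]
  have h1 := Submodule.mem_map_of_mem (f := LinearMap.mulLeft K (Ideal.Quotient.mk I (X i))) hu
  rw [Submodule.map_span] at h1
  refine Submodule.span_mono ?_ h1
  rintro _ ⟨_, ⟨v, ⟨hv, hvu⟩, rfl⟩, rfl⟩
  refine ⟨v + Pi.single i 1, ⟨?_, ?_⟩, monomialClass_add_single I v i⟩
  · rw [mem_antidiagonalTuple] at hv ⊢
    rw [sum_add_single, sum_add_single, hv]
  · obtain ⟨p, hp, hlt⟩ := toLex_lt_iff.1 hvu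
    exact toLex_lt_iff.2 ⟨p, fun j hj => by simp [hp j hj], by simpa using hlt⟩

open Classical in
theorem hilbertFunction_eq_card (I : Ideal (MvPolynomial (Fin m) K)) (t : ℕ) :
    hilbertFunction K I t = #((antidiagonalTuple m t).filter fun u => IsStandard I u) := by
  rw [hilbertFunction, gradedPiece_eq_span,
    finrank_span_image_eq_card (monomialClass I) toLex toLex.injective]
  refine congrArg _ (filter_congr fun u hu => ?_)
  rw [IsStandard, mem_antidiagonalTuple.1 hu]
  exact Iff.rfl

theorem isStandard_zero {I : Ideal (MvPolynomial (Fin m) K)} (hI : I ≠ ⊤) : IsStandard I 0 := by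
  have hempty : {v : Fin m → ℕ | v ∈ antidiagonalTuple m (∑ i, (0 : Fin m → ℕ) i) ∧
      toLex v < toLex 0} = ∅ := by
    rw [Set.eq_empty_iff_forall_notMem]
    rintro v ⟨-, hv⟩
    obtain ⟨p, -, hp⟩ := toLex_lt_iff.1 hv
    exact absurd hp (Nat.not_lt_zero _)
  rw [IsStandard, hempty, Set.image_empty, Submodule.span_empty, Submodule.mem_bot]
  intro h
  rw [monomialClass, Ideal.Quotient.eq_zero_iff_mem] at h
  refine hI ((Ideal.eq_top_iff_one I).2 ?_)
  convert h using 1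
  rw [← C_1, C_apply]
  congr 2
  ext i
  rfl

theorem IsHVector.exists_multicomplex {h : ℕ → ℕ} (hh : IsHVector K h)
    (hfin : h.support.Finite) :
    ∃ (m : ℕ) (M : Finset (Fin m → ℕ)), IsMulticomplex M ∧ ∀ t, h t = count M t := by
  classical
  obtain ⟨m, I, -, hdim, hH⟩ := hh
  -- The zero ring has Krull dimension `⊥`, not 0.
  have hI : I ≠ ⊤ := by
    rintro rfl
    have : Subsingleton (MvPolynomial (Fin m) K ⧸ (⊤ : Ideal (MvPolynomial (Fin m) K))) :=
      Ideal.Quotient.subsingleton_iff.2 rfl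
    rw [ringKrullDim_eq_bot_of_subsingleton] at hdim
    exact absurd hdim (by simp)
  obtain ⟨M, hM⟩ : ∃ M : Finset (Fin m → ℕ), ∀ u, u ∈ M ↔ IsStandard I u := by
    refine ⟨(hfin.toFinset.biUnion fun t => antidiagonalTuple m t).filter
      fun u => IsStandard I u, fun u => ?_⟩
    rw [mem_filter, and_iff_right_iff_imp]
    intro hu
    refine mem_biUnion.2 ⟨∑ i, u i, ?_, mem_antidiagonalTuple.2 rfl⟩
    rw [Set.Finite.mem_toFinset, Function.mem_support, hH, hilbertFunction_eq_card]
    exact card_ne_zero_of_mem (mem_filter.2 ⟨mem_antidiagonalTuple.2 rfl, hu⟩)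
  refine ⟨m, M, ⟨(hM 0).2 (isStandard_zero hI), fun u i hu =>
    (hM u).2 ((hM _).1 hu).of_add_single⟩, fun t => ?_⟩
  rw [hH, hilbertFunction_eq_card, count]
  congr 1
  ext u
  rw [mem_filter, mem_filter, mem_antidiagonalTuple, hM, and_comm]

/-- The monomial ideal spanned by the monomials outside a multicomplex. -/
def multicomplexIdeal (K : Type*) [Field K] {M : Finset (Fin m → ℕ)} (hM : IsMulticomplex M) :
    Ideal (MvPolynomial (Fin m) K) where
  carrier := {p | ∀ s : Fin m →₀ ℕ, ⇑s ∈ M → coeff s p = 0}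
  zero_mem' := fun s _ => coeff_zero s
  add_mem' := fun hp hq s hs => by rw [coeff_add, hp s hs, hq s hs, add_zero]
  smul_mem' := fun c p hp s hs => by
    rw [smul_eq_mul, coeff_mul]
    refine sum_eq_zero fun x hx => ?_
    rw [hp x.2 (hM.mem_of_le hs ?_), mul_zero]
    rw [← mem_antidiagonal.1 hx]
    intro i
    simp

theorem mem_multicomplexIdeal {M : Finset (Fin m → ℕ)} (hM : IsMulticomplex M)
    {p : MvPolynomial (Fin m) K} :
    p ∈ multicomplexIdeal K hM ↔ ∀ s : Fin m →₀ ℕ, ⇑s ∈ M → coeff s p = 0 := Iff.rfl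

theorem isStandard_multicomplexIdeal {M : Finset (Fin m → ℕ)} (hM : IsMulticomplex M)
    (u : Fin m → ℕ) : IsStandard (multicomplexIdeal K hM) u ↔ u ∈ M := by
  constructor
  · intro h
    by_contra hu
    apply h
    have : monomialClass (multicomplexIdeal K hM) u = 0 := by
      rw [monomialClass, Ideal.Quotient.eq_zero_iff_mem, mem_multicomplexIdeal]
      intro s hs
      rw [coeff_monomial, if_neg]
      rintro rfl
      exact hu hs
    rw [this]
    exact Submodule.zero_mem _
  · intro hu h
    have hker : ∀ p ∈ multicomplexIdeal K hM, coeff (Finsupp.equivFunOnFinite.symm u) p = 0 :=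
      fun p hp => hp _ (by simpa using hu)
    -- The coefficient at `u` descends to the quotient, kills all other monomials and is 1 on `u`.
    let φ : (MvPolynomial (Fin m) K ⧸ multicomplexIdeal K hM) →ₗ[K] K :=
      ((multicomplexIdeal K hM).restrictScalars K).liftQ
        (lcoeff K (Finsupp.equivFunOnFinite.symm u)) hker
    have hφ : ∀ v, φ (monomialClass _ v) = if v = u then 1 else 0 := by
      intro v
      change coeff _ (monomial _ (1 : K)) = _
      rw [coeff_monomial]
      simp
    have hle : Submodule.span K (monomialClass (multicomplexIdeal K hM) ''
        {v | v ∈ antidiagonalTuple m (∑ i, u i) ∧ toLex v < toLex u}) ≤ LinearMap.ker φ := by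
      rw [Submodule.span_le]
      rintro _ ⟨v, ⟨-, hv⟩, rfl⟩
      rw [SetLike.mem_coe, LinearMap.mem_ker, hφ, if_neg]
      rintro rfl
      exact lt_irrefl _ hv
    have := hle h
    rw [LinearMap.mem_ker, hφ, if_pos rfl] at this
    exact one_ne_zero this

theorem finite_quotient_multicomplexIdeal {M : Finset (Fin m → ℕ)} (hM : IsMulticomplex M) :
    Module.Finite K (MvPolynomial (Fin m) K ⧸ multicomplexIdeal K hM) := by
  let ψ : MvPolynomial (Fin m) K →ₗ[K] (M → K) :=
    LinearMap.pi fun u => lcoeff K (Finsupp.equivFunOnFinite.symm (u : Fin m → ℕ))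
  have hker : ∀ p, p ∈ multicomplexIdeal K hM ↔ ψ p = 0 := by
    intro p
    rw [mem_multicomplexIdeal]
    constructor
    · intro h
      ext u
      exact h _ (by simp)
    · intro h s hs
      have := congrFun h ⟨s, hs⟩
      simpa [ψ] using this
  let φ : (MvPolynomial (Fin m) K ⧸ multicomplexIdeal K hM) →ₗ[K] (M → K) :=
    ((multicomplexIdeal K hM).restrictScalars K).liftQ ψ fun p hp => (hker p).1 hp
  refine Module.Finite.of_injective φ ?_
  rw [injective_iff_map_eq_zero]
  intro x hx
  obtain ⟨p, rfl⟩ := Ideal.Quotient.mk_surjective x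
  exact Ideal.Quotient.eq_zero_iff_mem.2 ((hker p).2 hx)

theorem isHomogeneous_multicomplexIdeal {M : Finset (Fin m → ℕ)} (hM : IsMulticomplex M) :
    (multicomplexIdeal K hM).IsHomogeneous (homogeneousSubmodule (Fin m) K) := by
  intro t p hp
  have h : (DirectSum.decompose (homogeneousSubmodule (Fin m) K) p t : MvPolynomial (Fin m) K) =
      homogeneousComponent t p := decomposition.decompose'_apply p t
  rw [h]
  rw [mem_multicomplexIdeal] at hp ⊢
  intro s hs
  rw [coeff_homogeneousComponent, hp s hs, ite_self]

theorem IsMulticomplex.isHVector_count (K : Type*) [Field K] {M : Finset (Fin m → ℕ)}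
    (hM : IsMulticomplex M) : IsHVector K (count M) := by
  classical
  refine ⟨m, multicomplexIdeal K hM, isHomogeneous_multicomplexIdeal hM, ?_, fun t => ?_⟩
  · have hne : multicomplexIdeal K hM ≠ ⊤ := by
      intro h
      have h1 := (Ideal.eq_top_iff_one _).1 h
      rw [mem_multicomplexIdeal] at h1
      simpa using h1 0 hM.1
    have := Ideal.Quotient.nontrivial_iff.2 hne
    have := finite_quotient_multicomplexIdeal (K := K) hM
    have := IsArtinianRing.of_finite K (MvPolynomial (Fin m) K ⧸ multicomplexIdeal K hM)
    exact ringKrullDimZero_iff_ringKrullDim_eq_zero.1 inferInstance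
  · rw [hilbertFunction_eq_card, count]
    congr 1
    ext u
    rw [mem_filter, mem_filter, mem_antidiagonalTuple, isStandard_multicomplexIdeal, and_comm]

end Algebra

/-! ### Sums and supports of counts. -/

section Count

variable {m : ℕ}

theorem sum_range_count_le (M : Finset (Fin m → ℕ)) (D : ℕ) :
    ∑ t ∈ range D, count M t ≤ #M := by
  simp only [count]
  rw [sum_card_fiberwise_eq_card_filter]
  exact card_filter_le _ _

theorem support_count_subset (M : Finset (Fin m → ℕ)) :
    (count M).support ⊆ (M.image fun u => ∑ i, u i : Finset ℕ) := by
  intro t ht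
  obtain ⟨u, hu⟩ := card_ne_zero.1 ht
  rw [mem_filter] at hu
  exact mem_coe.2 (mem_image.2 ⟨u, hu⟩)

theorem finite_support_count (M : Finset (Fin m → ℕ)) : (count M).support.Finite :=
  (finite_toSet _).subset (support_count_subset M)

theorem finsum_count (M : Finset (Fin m → ℕ)) : ∑ᶠ t, count M t = #M := by
  rw [finsum_eq_sum_of_support_subset _ (support_count_subset M)]
  exact (card_eq_sum_card_image _ M).symm

theorem IsMulticomplex.count_zero {M : Finset (Fin m → ℕ)} (hM : IsMulticomplex M) :
    count M 0 = 1 := by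
  rw [count, card_eq_one]
  refine ⟨0, ?_⟩
  ext u
  rw [mem_filter, mem_singleton]
  constructor
  · exact fun h => eq_zero_of_sum_eq_zero h.2
  · rintro rfl
    exact ⟨hM.1, by simp⟩

theorem IsMulticomplex.count_pos_of_le {M : Finset (Fin m → ℕ)} (hM : IsMulticomplex M) {t : ℕ}
    (ht : 0 < count M t) : ∀ {r : ℕ}, r ≤ t → 0 < count M r := by
  induction t with
  | zero => intro r hr; rwa [Nat.le_zero.1 hr]
  | succ t ih =>
    intro r hr
    rcases hr.eq_or_lt with rfl | hr
    · exact ht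
    refine ih ?_ (Nat.lt_succ_iff.1 hr)
    obtain ⟨u, hu⟩ := card_pos.1 ht
    rw [mem_filter] at hu
    obtain ⟨u', i, rfl, -⟩ := exists_last_var hu.2
    rw [sum_add_single] at hu
    exact card_pos.2 ⟨u', mem_filter.2 ⟨hM.2 u' i hu.1, by omega⟩⟩

/-- A monomial of degree `t` has divisors in each of the degrees `0, …, t`, which makes at least `t
+ 1` elements. -/
theorem IsMulticomplex.count_eq_zero {M : Finset (Fin m → ℕ)} (hM : IsMulticomplex M) {t : ℕ}
    (ht : #M ≤ t) : count M t = 0 := by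
  by_contra h
  have h1 : ∑ r ∈ range (t + 1), 1 ≤ ∑ r ∈ range (t + 1), count M r :=
    sum_le_sum fun r hr =>
      hM.count_pos_of_le (Nat.pos_of_ne_zero h) (Nat.lt_succ_iff.1 (mem_range.1 hr))
  have h2 := sum_range_count_le M (t + 1)
  simp only [sum_const, card_range, smul_eq_mul, mul_one] at h1
  omega

theorem choose_succ_two (a : ℕ) : (a + 1).choose 2 = a + a.choose 2 := by
  rw [Nat.choose_succ_succ' a 1, Nat.choose_one_right]

theorem finsum_add_ite {h : ℕ → ℕ} (hfin : h.support.Finite) (a : ℕ) :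
    ∑ᶠ t, (h t + if a = t then 1 else 0) = ∑ᶠ t, h t + 1 := by
  have hsub : (fun t => if a = t then 1 else 0).support ⊆ {a} := fun t ht => by
    by_contra hne
    exact ht (if_neg (Ne.symm hne))
  rw [finsum_add_distrib hfin ((Set.finite_singleton a).subset hsub),
    finsum_eq_single (fun t => if a = t then 1 else 0) a fun t ht => if_neg (Ne.symm ht),
    if_pos rfl]

end Count

/-! ### Counting `h`-vectors, and the recurrence. -/

variable {K : Type*} [Field K]

theorem exists_multicomplex_of_mem_L {n : ℕ} (hn : 1 ≤ n) {h : ℕ → ℕ} (hh : h ∈ L K n) :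
    ∃ (m : ℕ) (M : Finset (Fin m → ℕ)), IsMulticomplex M ∧ h = count M ∧ #M = n := by
  have hfin : h.support.Finite := by
    -- A `finsum` over an infinite support is 0 by convention, which `1 ≤ n` excludes.
    by_contra hinf
    have := hh.2
    rw [finsum_of_infinite_support hinf] at this
    omega
  obtain ⟨m, M, hM, hc⟩ := hh.1.exists_multicomplex hfin
  have : h = count M := funext hc
  exact ⟨m, M, hM, this, by rw [← finsum_count, ← this, hh.2]⟩

theorem IsMulticomplex.count_mem_L {m : ℕ} {M : Finset (Fin m → ℕ)} (hM : IsMulticomplex M) :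
    count M ∈ L K #M := ⟨hM.isHVector_count K, finsum_count M⟩

theorem finite_L (K : Type*) [Field K] {n : ℕ} (hn : 1 ≤ n) : (L K n).Finite := by
  refine (Set.finite_range fun (a : Fin n → Fin (n + 1)) (t : ℕ) =>
    if ht : t < n then (a ⟨t, ht⟩ : ℕ) else 0).subset fun h hh => ?_
  obtain ⟨m, M, hM, rfl, hc⟩ := exists_multicomplex_of_mem_L hn hh
  refine ⟨fun t => ⟨count M t, ?_⟩, funext fun t => ?_⟩
  · have : count M t ≤ #M := card_filter_le _ _
    omega
  · by_cases ht : t < n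
    · simp [ht]
    · simp only [ht, dif_neg, not_false_eq_true]
      exact (hM.count_eq_zero (by omega)).symm

theorem Lk_zero_one (K : Type*) [Field K] :
    Lk K 0 1 = {count ({0} : Finset (Fin 0 → ℕ))} := by
  have h0 : IsMulticomplex ({0} : Finset (Fin 0 → ℕ)) :=
    ⟨mem_singleton_self _, fun _ i => i.elim0⟩
  ext h
  rw [Set.mem_singleton_iff]
  constructor
  · rintro ⟨hh, -⟩
    obtain ⟨m, M, hM, rfl, hc⟩ := exists_multicomplex_of_mem_L le_rfl hh
    ext t
    rcases Nat.eq_zero_or_pos t with rfl | ht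
    · rw [hM.count_zero, h0.count_zero]
    · rw [hM.count_eq_zero (by omega), h0.count_eq_zero (by rwa [card_singleton])]
  · rintro rfl
    exact ⟨h0.count_mem_L, h0.count_eq_zero (by simp)⟩

theorem ellk_succ (K : Type*) [Field K] {k n : ℕ} (hn : 1 ≤ n) (hk : n ≤ (k + 2).choose 2) :
    ellk K (k + 1) (n + 1) = ellk K k n := by
  refine (Set.ncard_congr (fun h _ t => h t + if 1 = t then 1 else 0) ?_ ?_ ?_).symm
  · rintro h ⟨hh, h1⟩
    obtain ⟨m, M, hM, rfl, hc⟩ := exists_multicomplex_of_mem_L hn hh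
    obtain ⟨N, hN, hNc⟩ := hM.exists_cone
    refine ⟨⟨?_, ?_⟩, by simpa using h1⟩
    · rw [← funext hNc]
      exact hN.isHVector_count K
    · rw [finsum_add_ite (finite_support_count M), finsum_count, hc]
  · intro h h' _ _ heq
    ext t
    exact Nat.add_right_cancel (congrFun heq t)
  · rintro h ⟨hh, h1⟩
    obtain ⟨m, M, hM, rfl, hc⟩ := exists_multicomplex_of_mem_L (by omega) hh
    -- `1 + (k+1) + h_2 ≤ n + 1` and `C(k+2,2) = (k+1) + C(k+1,2)`.
    have h2 : count M 2 ≤ (k + 1).choose 2 := by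
      have hsum := sum_range_count_le M 3
      rw [sum_range_succ, sum_range_succ, sum_range_one, hM.count_zero, h1, hc] at hsum
      rw [choose_succ_two (k + 1)] at hk
      omega
    obtain ⟨N, hN, hNc⟩ := hM.exists_erase h1 h2
    have hadd : (fun t => count N t + if 1 = t then 1 else 0) = count M := by
      ext t
      rw [hNc]
      split_ifs with ht
      · subst ht; omega
      · omega
    refine ⟨count N, ⟨⟨hN.isHVector_count K, ?_⟩, ?_⟩, hadd⟩
    · have h3 := finsum_add_ite (finite_support_count N) 1
      rw [hadd, finsum_count, hc] at h3
      omega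
    · rw [hNc, h1]
      simp

theorem s_le_iff {n k : ℕ} : s n ≤ k ↔ n ≤ (k + 2).choose 2 := by
  constructor
  · intro h
    have hmem : s n ∈ {k : ℕ | n ≤ (k + 2).choose 2} := by
      refine Nat.sInf_mem ⟨n, ?_⟩
      rw [Set.mem_ofPred_eq, choose_succ_two (n + 1)]
      omega
    exact le_trans hmem (Nat.choose_le_choose 2 (by omega))
  · exact fun h => Nat.sInf_le h

theorem s_mono {n n' : ℕ} (h : n ≤ n') : s n ≤ s n' :=
  s_le_iff.2 (h.trans (s_le_iff.1 le_rfl))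

theorem s_succ_le (n : ℕ) : s (n + 1) ≤ s n + 1 := by
  have h := s_le_iff.1 (le_refl (s n))
  rw [s_le_iff, choose_succ_two (s n + 2)]
  omega

theorem s_succ_le_self (n : ℕ) : s (n + 1) ≤ n := by
  rw [s_le_iff, choose_succ_two (n + 1)]
  omega

theorem tau_le_ell (K : Type*) [Field K] {n : ℕ} (hn : 1 ≤ n) : tau K n ≤ ell K n := by
  classical
  have hfin := finite_L K hn
  have hk : ∀ k, ellk K k n = #(hfin.toFinset.filter fun h => h 1 = k) := by
    intro k
    rw [ellk, ← Set.ncard_coe_finset]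
    congr 1
    ext h
    simp [Lk]
  rw [tau, ell, Set.ncard_eq_toFinset_card _ hfin, sum_congr rfl fun k _ => hk k,
    sum_card_fiberwise_eq_card_filter]
  exact card_filter_le _ _

/-- The condition `k ≥ s(n)` is precisely the hypothesis of `ellk_succ`, so the shift applies to
every term of `τ(n)`. -/
theorem sum_Ico_succ_ellk (K : Type*) [Field K] {n : ℕ} (hn : 1 ≤ n) :
    ∑ k ∈ Ico (s n + 1) (n + 1), ellk K k (n + 1) = tau K n := by
  rw [← sum_Ico_add' (fun k => ellk K k (n + 1)), tau]
  exact sum_congr rfl fun k hk => ellk_succ K hn (s_le_iff.1 (mem_Ico.1 hk).1)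

end HVec

theorem corollary4p3 (K : Type*) [Field K] :
    (∀ n : ℕ, 1 ≤ n → (HVec.L K n).Finite ∧ HVec.tau K n ≤ HVec.ell K n) ∧
    HVec.tau K 1 = 1 ∧
    (∀ n : ℕ, 2 ≤ n →
      HVec.s (n - 1) ≤ HVec.s n ∧
      (HVec.s n = HVec.s (n - 1) →
        HVec.tau K n = HVec.tau K (n - 1) + HVec.ellk K (HVec.s n) n) ∧
      (HVec.s n > HVec.s (n - 1) → HVec.tau K n = HVec.tau K (n - 1))) := by
  refine ⟨fun n hn => ⟨HVec.finite_L K hn, HVec.tau_le_ell K hn⟩, ?_, fun n hn => ?_⟩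
  · have hs : HVec.s 1 = 0 := Nat.le_zero.1 (HVec.s_succ_le_self 0)
    rw [HVec.tau, hs, Finset.sum_Ico_eq_sum_range, Finset.sum_range_one, HVec.ellk, Nat.add_zero,
      HVec.Lk_zero_one, Set.ncard_singleton]
  · obtain ⟨n, rfl⟩ : ∃ k, n = k + 1 := ⟨n - 1, by omega⟩
    rw [Nat.add_sub_cancel]
    have hsum := HVec.sum_Ico_succ_ellk K (n := n) (by omega)
    refine ⟨HVec.s_mono (Nat.le_succ n), fun h => ?_, fun h => ?_⟩
    -- Since `s(n+1) ≤ n`, the range is nonempty and its bottom term splits off.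
    · rw [← hsum, ← h, HVec.tau,
        Finset.sum_eq_sum_Ico_succ_bot (Nat.lt_succ_of_le (HVec.s_succ_le_self n)),
        Nat.add_comm (HVec.ellk K _ _)]
    · have hs : HVec.s (n + 1) = HVec.s n + 1 := le_antisymm (HVec.s_succ_le n) h
      rw [← hsum, ← hs, HVec.tau]
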